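/- Let $\mathbb K$ be an algebraically closed field, and let $X\subset W\subset\mathbb A^n_{\mathbb K}$ be affine varieties with vanishing ideals $I_W\subset I_X\subset\mathbb K[x_1,\dots,x_n]$. Suppose $I_W=\langle f_1,\dots,f_r\rangle$ (for example, $W$ a smooth complete intersection of codimension $r$ and $X$ equidimensional of positive codimension in $W$). Write $\mathbb K[W]=\mathbb K[x_1,\dots,x_n]/I_W$, let $\mathcal O_{W,p}$ be the local ring of $W$ at $p$ with maximal ideal $\mathfrak m_{W,p}$, and let $I_{X,W}=I_X\mathbb K[W]$. For $p\in W$ let $\operatorname{ord}_p(I_{X,W})=\sup\{k\in\mathbb N\mid I_{X,W}\mathcal O_{W,p}\subset\mathfrak m_{W,p}^k\}$, and put $$\operatorname{Sing}(I_{X,W},2)=\{p\in X\mid \operatorname{ord}_p(I_{X,W})\ge 2\}.$$ Let $C\subset\{1,\dots,n\}$ be a set of $r$ columns $c_1,\dots,c_r$, let $M=(\partial f_l/\partial x_{c_k})_{l,k}$ be the corresponding $r\times r$ submatrix of the Jacobian matrix of $f_1,\dots,f_r$, let $h=\det M$, let $D(h)=\{p\in\mathbb A^n_{\mathbb K}\mid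 h(p)\neq0\}$, and let $A$ be the matrix of cofactors (adjugate) of $M$. For a polynomial $f$ and $j\notin C$ define the relative derivative $$\frac{\partial f}{\partial X_j}:=h\,\frac{\partial f}{\partial x_j}-\sum_{k=1}^r\sum_{l=1}^r\frac{\partial f}{\partial x_{c_k}}\,A_{kl}\,\frac{\partial f_l}{\partial x_j}\in\mathbb K[x_1,\dots,x_n],$$ and set $\tilde f=h f-\sum_{k=1}^r\frac{\partial f}{\partial x_{c_k}}\tilde f_k$, where $(\tilde f_1,\dots,\tilde f_r)^T=A\cdot(f_1,\dots,f_r)^T$. Let $f_{r+1},\dots,f_s\in\mathbb K[x_1,\dots,x_n]$ represent a set of generators of the ideal $I_{X,W}$ of $\mathbb K[W]$. Then $$\operatorname{Sing}(I_{X,W},2)\cap D(h)=V\Big(I_X+\Big\langle \frac{\partial f_i}{\partial X_j}\;\Big|\; r+1\le i\le s,\ j\notin C\Big\rangle\Big)\cap D(h).$$ Moreover, the relative derivatives are computed by the cofactor construction: $A\cdot M=h\cdot E_r$, and for each $i=r+1,\dots,s$ one has $\tilde f_i-h f_i\in I_W$, $\ \partial\tilde f_i/\partial x_j-\partial f_i/\partial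 X_j\in I_W+\langle f_i\rangle$ for all $j\notin C$, and $\partial\tilde f_i/\partial x_j\in I_W+\langle f_i\rangle$ for all $j\in C$ (here $\tilde f_i$ for $i>r$ is the polynomial $\tilde f$ formed from $f=f_i$). -/

import Mathlib

open MvPolynomial

noncomputable section

namespace LocusOrderTwo

variable {K : Type*} [Field K] {n : ℕ}

/-- An affine variety in `K^n`: the common vanishing locus of finitely many polynomials. -/
def IsAffineVariety (Z : Set (Fin n → K)) : Prop :=
  ∃ S : Finset (MvPolynomial (Fin n) K), Z = {p | ∀ f ∈ S, eval p f = 0}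

/-- The principal open set `D(h) = {p | h(p) ≠ 0}`. -/
def principalOpen (h : MvPolynomial (Fin n) K) : Set (Fin n → K) :=
  {p | eval p h ≠ 0}

/-- The coordinate ring `K[W] = K[x_1, …, x_n] / I_W`. -/
abbrev CoordRing (W : Set (Fin n → K)) : Type _ :=
  MvPolynomial (Fin n) K ⧸ vanishingIdeal K W

/-- The vanishing ideal `I_{X,W}` of `X` in `W`: the ideal of `K[W]` generated by `I_X`. -/
def relVanishingIdeal (X W : Set (Fin n → K)) : Ideal (CoordRing W) :=
  (vanishingIdeal K X).map (Ideal.Quotient.mk (vanishingIdeal K W))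

/-- Evaluation of polynomial functions on `W` at a point of `W`. -/
def evalAt (W : Set (Fin n → K)) (p : W) : CoordRing W →+* K :=
  Ideal.Quotient.lift (vanishingIdeal K W) (eval (p : Fin n → K)) fun f hf => by
    have h := hf (p : Fin n → K) p.2
    rwa [aeval_eq_eval] at h

instance evalAt_ker_isPrime (W : Set (Fin n → K)) (p : W) :
    (RingHom.ker (evalAt W p)).IsPrime :=
  RingHom.ker_isPrime (evalAt W p)

/-- The local ring `𝒪_{W,p}`: the localization of `K[W]` at the prime ideal of the functions
vanishing at `p`. -/
abbrev LocalRingAt (W : Set (Fin n → K)) (p : W) : Type _ :=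
  Localization.AtPrime (RingHom.ker (evalAt W p))

/-- The order of an ideal `J` of a local ring `(R, 𝔪)`: the largest `k` with `J ⊆ 𝔪 ^ k`. In a
Noetherian local ring it is attained for `J ≠ 0`, and equals `⊤` for `J = 0`. -/
def idealOrder {R : Type*} [CommRing R] [IsLocalRing R] (J : Ideal R) : ℕ∞ :=
  sSup {k : ℕ∞ | ∃ m : ℕ, k = m ∧ J ≤ IsLocalRing.maximalIdeal R ^ m}

/-- The order at `p ∈ W` of an ideal `I` of `K[W]`: the order of its extension to `𝒪_{W,p}`. -/
def orderAt (W : Set (Fin n → K)) (p : W) (I : Ideal (CoordRing W)) : ℕ∞ :=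
  idealOrder (I.map (algebraMap (CoordRing W) (LocalRingAt W p)))

/-- The locus `Sing(I_{X,W}, b) = {p ∈ X | ord_p(I_{X,W}) ≥ b}` of order at least `b`. -/
def singLocus (X W : Set (Fin n → K)) (hXW : X ⊆ W) (b : ℕ) : Set (Fin n → K) :=
  {p | ∃ hp : p ∈ X, (b : ℕ∞) ≤ orderAt W ⟨p, hXW hp⟩ (relVanishingIdeal X W)}

variable {r : ℕ}

/-- The Jacobian matrix `(∂F_l / ∂x_j)` of `F_1, …, F_r`. -/
def jacobian (F : Fin r → MvPolynomial (Fin n) K) :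
    Matrix (Fin r) (Fin n) (MvPolynomial (Fin n) K) :=
  Matrix.of fun l j => pderiv j (F l)

/-- The `r × r` submatrix `M` of the Jacobian matrix formed by the columns `c 0, …, c (r-1)`. -/
def chartMatrix (F : Fin r → MvPolynomial (Fin n) K) (c : Fin r ↪ Fin n) :
    Matrix (Fin r) (Fin r) (MvPolynomial (Fin n) K) :=
  (jacobian F).submatrix id c

/-- The maximal minor `h = det M`. -/
def chartMinor (F : Fin r → MvPolynomial (Fin n) K) (c : Fin r ↪ Fin n) :
    MvPolynomial (Fin n) K :=
  (chartMatrix F c).det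

/-- The cofactor matrix `A` of `M`, normalized as usual so that `A * M = h • 1`. -/
def cofactors (F : Fin r → MvPolynomial (Fin n) K) (c : Fin r ↪ Fin n) :
    Matrix (Fin r) (Fin r) (MvPolynomial (Fin n) K) :=
  (chartMatrix F c).adjugate

/-- The modified equations `(F̃_1, …, F̃_r)ᵀ = A (F_1, …, F_r)ᵀ`. -/
def tildeGens (F : Fin r → MvPolynomial (Fin n) K) (c : Fin r ↪ Fin n) :
    Fin r → MvPolynomial (Fin n) K :=
  (cofactors F c).mulVec F

/-- The modified polynomial `f̃ = h f - ∑ₖ (∂f/∂x_{c k}) F̃_k`. -/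
def tildePoly (F : Fin r → MvPolynomial (Fin n) K) (c : Fin r ↪ Fin n)
    (f : MvPolynomial (Fin n) K) : MvPolynomial (Fin n) K :=
  chartMinor F c * f - ∑ k, pderiv (c k) f * tildeGens F c k

/-- The relative derivative `∂f/∂X_j`: the entry in column `j` that remains when the row
`h • (∂f/∂x_1, …, ∂f/∂x_n)` is reduced by the rows of `A * (∂F_l/∂x_j)`, whose columns
`c 0, …, c (r-1)` form the matrix `h • 1`. Explicitly,
`h ∂f/∂x_j - ∑ₖ ∑ₗ (∂f/∂x_{c k}) A_{k l} (∂F_l/∂x_j)`. -/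
def relDeriv (F : Fin r → MvPolynomial (Fin n) K) (c : Fin r ↪ Fin n)
    (f : MvPolynomial (Fin n) K) (j : Fin n) : MvPolynomial (Fin n) K :=
  chartMinor F c * pderiv j f - ∑ k, pderiv (c k) f * (cofactors F c * jacobian F) k j

/-- The ideal `⟨∂f_i/∂X_j⟩`, with `i` running over the given polynomials and `j` over the
variables not used for differentiation in forming the minor. -/
def relDerivIdeal (F : Fin r → MvPolynomial (Fin n) K) (c : Fin r ↪ Fin n) {m : ℕ}
    (f : Fin m → MvPolynomial (Fin n) K) : Ideal (MvPolynomial (Fin n) K) :=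
  Ideal.span {q | ∃ (i : Fin m) (j : Fin n), j ∉ Set.range c ∧ q = relDeriv F c (f i) j}

end LocusOrderTwo

end

namespace LocusOrderTwo

variable {K : Type*} [Field K] {n r : ℕ}

/-! Each relative derivative is a derivation of the polynomial ring that kills every `F l`, so at
points of `W` its value depends only on the class modulo `I_W`. If `g * f` agrees with some `q ∈ 𝔪_p
^ 2` modulo `I_W` and `g(p) ≠ 0`, applying it at `p ∈ X` gives `g(p) (∂f/∂X_j)(p) = 0`. Conversely,
`f̃` agrees with `h f` modulo `I_W`, and at `p` all its ordinary partials equal the relative ones.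
If these vanish, Taylor expansion puts `f̃` in `𝔪_p ^ 2`, and `h` is a unit at `p`.
`germ_mem_sq_iff_relDeriv` combines the two directions. -/

/-! ### Relative derivatives and the cofactor reduction -/

theorem cofactors_mul_chartMatrix (F : Fin r → MvPolynomial (Fin n) K) (c : Fin r ↪ Fin n) :
    cofactors F c * chartMatrix F c =
      chartMinor F c • (1 : Matrix (Fin r) (Fin r) (MvPolynomial (Fin n) K)) :=
  Matrix.adjugate_mul _

theorem cofactors_mul_jacobian_apply (F : Fin r → MvPolynomial (Fin n) K) (c : Fin r ↪ Fin n)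
    (k l : Fin r) :
    (cofactors F c * jacobian F) k (c l) = if k = l then chartMinor F c else 0 := by
  have h := congrFun (congrFun (cofactors_mul_chartMatrix F c) k) l
  rw [Matrix.smul_apply, Matrix.one_apply, smul_eq_mul, mul_ite, mul_one, mul_zero] at h
  exact h

theorem relDeriv_chart (F : Fin r → MvPolynomial (Fin n) K) (c : Fin r ↪ Fin n)
    (f : MvPolynomial (Fin n) K) (l : Fin r) : relDeriv F c f (c l) = 0 := by
  simp [relDeriv, cofactors_mul_jacobian_apply, mul_comm]

/-- Here the other adjugate identity `M * A = h • 1` is needed: it gives `M * (A * Jac) = h • Jac`,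
and row `l` of this is the cancellation. -/
theorem relDeriv_gen (F : Fin r → MvPolynomial (Fin n) K) (c : Fin r ↪ Fin n)
    (l : Fin r) (j : Fin n) : relDeriv F c (F l) j = 0 := by
  have h : chartMatrix F c * (cofactors F c * jacobian F) = chartMinor F c • jacobian F := by
    rw [← Matrix.mul_assoc, cofactors, Matrix.mul_adjugate, Matrix.smul_mul, Matrix.one_mul]
    rfl
  have h' := congrFun (congrFun h l) j
  rw [Matrix.mul_apply, Matrix.smul_apply, smul_eq_mul] at h'
  exact sub_eq_zero.2 h'.symm

/-- The relative derivative as a derivation of the polynomial ring. -/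
noncomputable def relDerivation (F : Fin r → MvPolynomial (Fin n) K) (c : Fin r ↪ Fin n) (j : Fin n) :
    Derivation K (MvPolynomial (Fin n) K) (MvPolynomial (Fin n) K) :=
  chartMinor F c • pderiv j - ∑ k, (cofactors F c * jacobian F) k j • pderiv (c k)

theorem relDerivation_apply (F : Fin r → MvPolynomial (Fin n) K) (c : Fin r ↪ Fin n) (j : Fin n)
    (f : MvPolynomial (Fin n) K) : relDerivation F c j f = relDeriv F c f j := by
  have h : (∑ k, (cofactors F c * jacobian F) k j • pderiv (R := K) (c k)) f =
      ∑ k, (cofactors F c * jacobian F) k j • pderiv (c k) f := by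
    rw [← Derivation.coeFnAddMonoidHom_apply, map_sum, Finset.sum_apply]
    rfl
  simp [relDerivation, relDeriv, h, mul_comm]

theorem tildeGens_mem (F : Fin r → MvPolynomial (Fin n) K) (c : Fin r ↪ Fin n) (k : Fin r) :
    tildeGens F c k ∈ Ideal.span (Set.range F) := by
  change ∑ l, cofactors F c k l * F l ∈ _
  exact Ideal.sum_mem _ fun l _ => Ideal.mul_mem_left _ _ (Ideal.subset_span (Set.mem_range_self l))

/-- By the product rule, what remains are the terms in which a cofactor is differentiated and some
`F l` survives as a factor. -/
theorem pderiv_tildeGens_sub_mem (F : Fin r → MvPolynomial (Fin n) K) (c : Fin r ↪ Fin n)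
    (k : Fin r) (j : Fin n) :
    pderiv j (tildeGens F c k) - (cofactors F c * jacobian F) k j ∈
      Ideal.span (Set.range F) := by
  have h : pderiv j (tildeGens F c k) - (cofactors F c * jacobian F) k j =
      ∑ l, pderiv j (cofactors F c k l) * F l := by
    simp only [tildeGens, Matrix.mulVec, dotProduct, map_sum, Derivation.leibniz, smul_eq_mul,
      Matrix.mul_apply, jacobian, Matrix.of_apply, ← Finset.sum_sub_distrib]
    exact Finset.sum_congr rfl fun l _ => by ring
  rw [h]
  exact Ideal.sum_mem _ fun l _ => Ideal.mul_mem_left _ _ (Ideal.subset_span ⟨l, rfl⟩)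

theorem tildePoly_sub_mem (F : Fin r → MvPolynomial (Fin n) K) (c : Fin r ↪ Fin n)
    (f : MvPolynomial (Fin n) K) :
    tildePoly F c f - chartMinor F c * f ∈ Ideal.span (Set.range F) := by
  rw [tildePoly, sub_sub_cancel_left]
  exact neg_mem (Ideal.sum_mem _ fun k _ => Ideal.mul_mem_left _ _ (tildeGens_mem F c k))

theorem pderiv_tildePoly_sub_mem (F : Fin r → MvPolynomial (Fin n) K) (c : Fin r ↪ Fin n)
    (f : MvPolynomial (Fin n) K) (j : Fin n) :
    pderiv j (tildePoly F c f) - relDeriv F c f j ∈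
      Ideal.span (Set.range F) ⊔ Ideal.span {f} := by
  have h : pderiv j (tildePoly F c f) - relDeriv F c f j =
      -(∑ k, (pderiv (c k) f * (pderiv j (tildeGens F c k) - (cofactors F c * jacobian F) k j) +
        pderiv j (pderiv (c k) f) * tildeGens F c k)) + pderiv j (chartMinor F c) * f := by
    simp only [tildePoly, relDeriv, map_sub, map_sum, Derivation.leibniz, smul_eq_mul, mul_sub,
      Finset.sum_add_distrib, Finset.sum_sub_distrib]
    simp only [mul_comm (tildeGens F c _)]
    ring
  rw [h]
  refine Ideal.add_mem _ (Ideal.mem_sup_left (neg_mem (Ideal.sum_mem _ fun k _ =>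
    Ideal.add_mem _ ?_ ?_))) (Ideal.mem_sup_right ?_)
  · exact Ideal.mul_mem_left _ _ (pderiv_tildeGens_sub_mem F c k j)
  · exact Ideal.mul_mem_left _ _ (tildeGens_mem F c k)
  · exact Ideal.mul_mem_left _ _ (Ideal.mem_span_singleton_self f)

/-! ### Squares of maximal ideals and derivations -/

/-- First-order Taylor expansion at a point. -/
theorem sub_taylor_mem_sq (p : Fin n → K) (f : MvPolynomial (Fin n) K) :
    f - C (eval p f) - ∑ j, C (eval p (pderiv j f)) * (X j - C (p j)) ∈
      RingHom.ker (eval p) ^ 2 := by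
  have hX (i : Fin n) : (X i - C (p i) : MvPolynomial (Fin n) K) ∈ RingHom.ker (eval p) := by
    simp [RingHom.mem_ker]
  induction f using MvPolynomial.induction_on with
  | C a => simp
  | add f g hf hg =>
    convert Ideal.add_mem _ hf hg using 1
    simp only [map_add, add_mul, Finset.sum_add_distrib]
    ring
  | mul_X f i hf =>
    -- Writing `X i = p i + (X i - p i)` expresses the new remainder as `p i` times the old one plus
    -- a product of two elements of `𝔪_p`.
    have h : f * X i - C (eval p (f * X i)) -
        ∑ j, C (eval p (pderiv j (f * X i))) * (X j - C (p j)) =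
        C (p i) * (f - C (eval p f) - ∑ j, C (eval p (pderiv j f)) * (X j - C (p j))) +
          (f - C (eval p f)) * (X i - C (p i)) := by
      have h1 : ∑ j, C (eval p (pderiv j (f * X i))) * (X j - C (p j)) =
          C (eval p f) * (X i - C (p i)) +
            C (p i) * ∑ j, C (eval p (pderiv j f)) * (X j - C (p j)) := by
        simp only [Derivation.leibniz, smul_eq_mul, map_add, map_mul, eval_X, add_mul,
          Finset.sum_add_distrib, Finset.mul_sum]
        congr 1
        · rw [Finset.sum_eq_single i]
          · simp
          · intro j _ hj
            simp [pderiv_X_of_ne hj.symm]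
          · simp
        · exact Finset.sum_congr rfl fun j _ => by ring
      rw [h1, map_mul, eval_X, map_mul]
      ring
    rw [h]
    refine Ideal.add_mem _ (Ideal.mul_mem_left _ _ hf) ?_
    rw [pow_two]
    exact Ideal.mul_mem_mul (by simp [RingHom.mem_ker]) (hX i)

theorem mem_sq_of_pderiv_eq_zero {p : Fin n → K} {f : MvPolynomial (Fin n) K}
    (h0 : eval p f = 0) (h1 : ∀ j, eval p (pderiv j f) = 0) : f ∈ RingHom.ker (eval p) ^ 2 := by
  simpa [h0, h1] using sub_taylor_mem_sq p f

theorem eval_derivation_eq_zero_of_mem_sq {p : Fin n → K}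
    (D : Derivation K (MvPolynomial (Fin n) K) (MvPolynomial (Fin n) K))
    {f : MvPolynomial (Fin n) K} (hf : f ∈ RingHom.ker (eval p) ^ 2) : eval p (D f) = 0 := by
  rw [pow_two] at hf
  induction hf using Submodule.mul_induction_on' with
  | mem_mul_mem a ha b hb =>
    rw [RingHom.mem_ker] at ha hb
    simp [ha, hb]
  | add a _ b _ ha hb => simp [ha, hb]

theorem eval_derivation_eq_zero_of_mem_span {p : Fin n → K}
    (D : Derivation K (MvPolynomial (Fin n) K) (MvPolynomial (Fin n) K))
    {F : Fin r → MvPolynomial (Fin n) K} (h0 : ∀ l, eval p (F l) = 0)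
    (h1 : ∀ l, eval p (D (F l)) = 0) {f : MvPolynomial (Fin n) K}
    (hf : f ∈ Ideal.span (Set.range F)) : eval p (D f) = 0 := by
  obtain ⟨a, rfl⟩ := (Ideal.mem_span_range_iff_exists_fun).1 hf
  simp [h0, h1]

/-! ### Orders and germs in the local ring -/

/-- Powers of the maximal ideal decrease, so if the inclusion fails for exponent 2, every admissible
exponent is at most 1, and so is the supremum. -/
theorem two_le_idealOrder_iff {R : Type*} [CommRing R] [IsLocalRing R] (J : Ideal R) :
    2 ≤ idealOrder J ↔ J ≤ IsLocalRing.maximalIdeal R ^ 2 := by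
  constructor
  · intro h
    by_contra hJ
    have : idealOrder J ≤ 1 := by
      refine sSup_le ?_
      rintro _ ⟨m, rfl, hm⟩
      by_contra h1
      have h2 : 2 ≤ m := by
        have : 1 < m := by exact_mod_cast not_le.1 h1
        omega
      exact hJ (hm.trans (Ideal.pow_le_pow_right h2))
    exact absurd (h.trans this) (by decide)
  · intro h
    exact le_sSup ⟨2, rfl, h⟩

theorem ker_evalAt (W : Set (Fin n → K)) (p : W) :
    RingHom.ker (evalAt W p) =
      (RingHom.ker (eval (p : Fin n → K))).map (Ideal.Quotient.mk (vanishingIdeal K W)) := by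
  ext x
  rw [Ideal.mem_map_iff_of_surjective _ Ideal.Quotient.mk_surjective]
  constructor
  · obtain ⟨x, rfl⟩ := Ideal.Quotient.mk_surjective x
    exact fun h => ⟨x, h, rfl⟩
  · rintro ⟨x, h, rfl⟩
    exact h

/-- Membership of the germ of a polynomial in the square of the maximal ideal of `𝒪_{W,p}`. -/
theorem germ_mem_sq_iff (W : Set (Fin n → K)) (p : W) (f : MvPolynomial (Fin n) K) :
    algebraMap (CoordRing W) (LocalRingAt W p) (Ideal.Quotient.mk (vanishingIdeal K W) f) ∈
        IsLocalRing.maximalIdeal (LocalRingAt W p) ^ 2 ↔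
      ∃ g q, eval (p : Fin n → K) g ≠ 0 ∧ q ∈ RingHom.ker (eval (p : Fin n → K)) ^ 2 ∧
        g * f - q ∈ vanishingIdeal K W := by
  rw [← Localization.AtPrime.map_eq_maximalIdeal, ← Ideal.map_pow,
    IsLocalization.algebraMap_mem_map_algebraMap_iff (RingHom.ker (evalAt W p)).primeCompl]
  have hsq : RingHom.ker (evalAt W p) ^ 2 = (RingHom.ker (eval (p : Fin n → K)) ^ 2).map
      (Ideal.Quotient.mk (vanishingIdeal K W)) := by
    rw [ker_evalAt, Ideal.map_pow]
  rw [hsq]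
  constructor
  · rintro ⟨g, hg, hgf⟩
    obtain ⟨g, rfl⟩ := Ideal.Quotient.mk_surjective g
    obtain ⟨q, hq, hqe⟩ := (Ideal.mem_map_iff_of_surjective _ Ideal.Quotient.mk_surjective).1 hgf
    refine ⟨g, q, fun h => hg ?_, hq, ?_⟩
    · rw [ker_evalAt]
      exact Ideal.mem_map_of_mem _ h
    · rw [← Ideal.Quotient.eq, map_mul, hqe]
  · rintro ⟨g, q, hg, hq, hgf⟩
    refine ⟨Ideal.Quotient.mk _ g, fun h => hg h, ?_⟩
    rw [← map_mul, Ideal.Quotient.eq.2 hgf]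
    exact Ideal.mem_map_of_mem _ hq

/-- On the chart `h ≠ 0` the germ of `f` has order at least two exactly when the relative
derivatives of `f` vanish. -/
theorem germ_mem_sq_iff_relDeriv {W : Set (Fin n → K)} {F : Fin r → MvPolynomial (Fin n) K}
    (hF : vanishingIdeal K W = Ideal.span (Set.range F)) (c : Fin r ↪ Fin n) (p : W)
    (hp : eval (p : Fin n → K) (chartMinor F c) ≠ 0) {f : MvPolynomial (Fin n) K}
    (hf : eval (p : Fin n → K) f = 0) :
    algebraMap (CoordRing W) (LocalRingAt W p) (Ideal.Quotient.mk (vanishingIdeal K W) f) ∈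
        IsLocalRing.maximalIdeal (LocalRingAt W p) ^ 2 ↔
      ∀ j ∉ Set.range c, eval (p : Fin n → K) (relDeriv F c f j) = 0 := by
  have hW {g : MvPolynomial (Fin n) K} (hg : g ∈ Ideal.span (Set.range F)) :
      eval (p : Fin n → K) g = 0 := by
    rw [← hF] at hg
    simpa [aeval_eq_eval] using hg p p.2
  rw [germ_mem_sq_iff]
  constructor
  · rintro ⟨g, q, hg, hq, hgf⟩ j -
    rw [hF] at hgf
    have h1 := eval_derivation_eq_zero_of_mem_sq (relDerivation F c j) hq
    have h2 := eval_derivation_eq_zero_of_mem_span (relDerivation F c j)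
      (fun l => hW (Ideal.subset_span ⟨l, rfl⟩))
      (fun l => by rw [relDerivation_apply, relDeriv_gen, map_zero]) hgf
    rw [map_sub, map_sub, h1, sub_zero, Derivation.leibniz, relDerivation_apply] at h2
    simpa [hf, hg] using h2
  · intro h
    -- The denominator is `h` itself, and `f̃` is the representative of `h f` modulo `I_W` whose
    -- full gradient vanishes at `p`.
    refine ⟨chartMinor F c, tildePoly F c f, hp, mem_sq_of_pderiv_eq_zero ?_ fun j => ?_, ?_⟩
    · have := hW (tildePoly_sub_mem F c f)
      simpa [hf] using this
    · have hle : Ideal.span (Set.range F) ⊔ Ideal.span {f} ≤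
          RingHom.ker (eval (p : Fin n → K)) :=
        sup_le (fun g hg => hW hg) ((Ideal.span_singleton_le_iff_mem _).2 hf)
      have h1 := RingHom.mem_ker.1 (hle (pderiv_tildePoly_sub_mem F c f j))
      rw [map_sub, sub_eq_zero] at h1
      rw [h1]
      by_cases hj : j ∈ Set.range c
      · obtain ⟨l, rfl⟩ := hj
        rw [relDeriv_chart, map_zero]
      · exact h j hj
    · rw [hF, ← neg_mem_iff, neg_sub]
      exact tildePoly_sub_mem F c f

/-! ### Passing from germs to zero loci -/

theorem IsAffineVariety.mem_iff {Z : Set (Fin n → K)} (hZ : IsAffineVariety Z) (p : Fin n → K) :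
    p ∈ Z ↔ ∀ g ∈ vanishingIdeal K Z, eval p g = 0 := by
  constructor
  · intro hp g hg
    simpa [aeval_eq_eval] using hg p hp
  · obtain ⟨S, rfl⟩ := hZ
    intro h g hg
    refine h g fun q hq => ?_
    rw [aeval_eq_eval]
    exact hq g hg

theorem mem_singLocus_iff {X W : Set (Fin n → K)} (hXW : X ⊆ W) {m : ℕ}
    {f : Fin m → MvPolynomial (Fin n) K}
    (hf : relVanishingIdeal X W =
      Ideal.span (Set.range fun i => Ideal.Quotient.mk (vanishingIdeal K W) (f i)))
    (p : Fin n → K) :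
    p ∈ singLocus X W hXW 2 ↔ ∃ hp : p ∈ X, ∀ i,
      algebraMap (CoordRing W) (LocalRingAt W ⟨p, hXW hp⟩)
        (Ideal.Quotient.mk (vanishingIdeal K W) (f i)) ∈
          IsLocalRing.maximalIdeal (LocalRingAt W ⟨p, hXW hp⟩) ^ 2 := by
  refine exists_congr fun hp => ?_
  rw [orderAt, Nat.cast_ofNat, two_le_idealOrder_iff, hf, Ideal.map_le_iff_le_comap,
    Ideal.span_le, Set.range_subset_iff]
  rfl

theorem eval_eq_zero_of_mk_mem {X W : Set (Fin n → K)} (hXW : X ⊆ W)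
    {f : MvPolynomial (Fin n) K}
    (hf : Ideal.Quotient.mk (vanishingIdeal K W) f ∈ relVanishingIdeal X W)
    {p : Fin n → K} (hp : p ∈ X) : eval p f = 0 := by
  obtain ⟨g, hg, hgf⟩ := (Ideal.mem_map_iff_of_surjective _ Ideal.Quotient.mk_surjective).1 hf
  have h1 := hg p hp
  have h2 := Ideal.Quotient.eq.1 hgf p (hXW hp)
  rw [aeval_eq_eval] at h1 h2
  have h3 : eval p g - eval p f = 0 := by simpa using h2
  have h4 : eval p g = 0 := by simpa using h1
  rwa [h4, zero_sub, neg_eq_zero] at h3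

theorem mem_zeroLocus_sup_relDerivIdeal_iff {X : Set (Fin n → K)} (hX : IsAffineVariety X)
    (F : Fin r → MvPolynomial (Fin n) K) (c : Fin r ↪ Fin n) {m : ℕ}
    (f : Fin m → MvPolynomial (Fin n) K) (p : Fin n → K) :
    p ∈ zeroLocus K (vanishingIdeal K X ⊔ relDerivIdeal F c f) ↔
      p ∈ X ∧ ∀ i, ∀ j ∉ Set.range c, eval p (relDeriv F c (f i) j) = 0 := by
  have h : p ∈ zeroLocus K (vanishingIdeal K X ⊔ relDerivIdeal F c f) ↔
      vanishingIdeal K X ⊔ relDerivIdeal F c f ≤ RingHom.ker (eval p) := by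
    simp only [mem_zeroLocus_iff, aeval_eq_eval]
    rfl
  rw [h, sup_le_iff, hX.mem_iff, relDerivIdeal, Ideal.span_le]
  refine and_congr Iff.rfl ⟨fun H i j hj => H ⟨i, j, hj, rfl⟩, ?_⟩
  rintro H _ ⟨i, j, hj, rfl⟩
  exact H i j hj

end LocusOrderTwo

theorem mainTheorem2 {K : Type*} [Field K] [IsAlgClosed K] {n r m : ℕ}
    (X W : Set (Fin n → K))
    (hX : LocusOrderTwo.IsAffineVariety X) (hW : LocusOrderTwo.IsAffineVariety W)
    (hXW : X ⊆ W)
    (F : Fin r → MvPolynomial (Fin n) K)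
    (hF : vanishingIdeal K W = Ideal.span (Set.range F))
    (c : Fin r ↪ Fin n)
    (f : Fin m → MvPolynomial (Fin n) K)
    (hf : LocusOrderTwo.relVanishingIdeal X W =
      Ideal.span (Set.range fun i => Ideal.Quotient.mk (vanishingIdeal K W) (f i))) :
    -- the locus of order at least two on the chart
    LocusOrderTwo.singLocus X W hXW 2 ∩
        LocusOrderTwo.principalOpen (LocusOrderTwo.chartMinor F c) =
      zeroLocus K (vanishingIdeal K X ⊔ LocusOrderTwo.relDerivIdeal F c f) ∩
        LocusOrderTwo.principalOpen (LocusOrderTwo.chartMinor F c) ∧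
    -- the recipe that computes the relative derivatives
    LocusOrderTwo.cofactors F c * LocusOrderTwo.chartMatrix F c =
      LocusOrderTwo.chartMinor F c • (1 : Matrix (Fin r) (Fin r) (MvPolynomial (Fin n) K)) ∧
    ∀ i : Fin m,
      LocusOrderTwo.tildePoly F c (f i) - LocusOrderTwo.chartMinor F c * f i
        ∈ vanishingIdeal K W ∧
      (∀ j ∉ Set.range c,
        pderiv j (LocusOrderTwo.tildePoly F c (f i)) - LocusOrderTwo.relDeriv F c (f i) j
          ∈ vanishingIdeal K W ⊔ Ideal.span {f i}) ∧
      (∀ j ∈ Set.range c,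
        pderiv j (LocusOrderTwo.tildePoly F c (f i))
          ∈ vanishingIdeal K W ⊔ Ideal.span {f i}) := by
  open LocusOrderTwo in
  refine ⟨?_, cofactors_mul_chartMatrix F c, fun i => ?_⟩
  · ext p
    refine and_congr_left fun hp => ?_
    rw [mem_singLocus_iff hXW hf, mem_zeroLocus_sup_relDerivIdeal_iff hX, ← exists_prop]
    refine exists_congr fun hpX => forall_congr' fun i => ?_
    refine germ_mem_sq_iff_relDeriv hF c ⟨p, hXW hpX⟩ hp (eval_eq_zero_of_mk_mem hXW ?_ hpX)
    rw [hf]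
    exact Ideal.subset_span ⟨i, rfl⟩
  · rw [hF]
    refine ⟨tildePoly_sub_mem F c (f i), fun j _ => pderiv_tildePoly_sub_mem F c (f i) j, ?_⟩
    rintro _ ⟨l, rfl⟩
    -- In a chart column the relative derivative is identically zero, so the congruence reduces to
    -- membership.
    simpa [relDeriv_chart] using pderiv_tildePoly_sub_mem F c (f i) (c l)
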